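/- Let $n\ge 2$. Let $\mathbb{R}^{n,1}=\mathbb{R}^n\times\mathbb{R}$ be Minkowski space with the form $\langle X,Y\rangle=X'\cdot Y'-X_{n+1}Y_{n+1}$, time-oriented by $X_{n+1}$, let $\mathbb{H}=\{x:\langle x,x\rangle=-1,\ x_{n+1}>0\}$ be the future unit hyperboloid (hyperbolic space), fix a point $o\in\mathbb{H}$, and let $r(x)=\operatorname{arcosh}(-\langle o,x\rangle)$ be the hyperbolic distance from $o$ to $x\in\mathbb{H}$. For $\varphi:\mathbb{H}\to\mathbb{R}$, the radial graph of $\varphi$ is $\{e^{\varphi(x)}x : x\in\mathbb{H}\}$; $\varphi$ is called spacelike if the metric induced on this graph is Riemannian. In that case let $N$ be the future oriented unit normal field of the graph; the principal curvatures $\kappa_1,\dots,\kappa_n$ are the eigenvalues of $dN$, and $H_m=\sigma_m(\kappa_1,\dots,\kappa_n)$ is the $m$-th elementary symmetric function of them. The function $\varphi$ is called admissible if it is spacelike and $H_1>0$, $H_2>0$ everywhere on its graph; and $$F_2(\varphi)(x)=e^{\varphi(x)}\left[\binom n2^{-1}H_2\right]^{1/2},$$ where $H_2$ is taken at the point $e^{\varphi(x)}x$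 of the graph. Let $\alpha\in(0,1)$, let $h:[0,+\infty)\to\mathbb{R}$ be a positive function of class $C^{2,\alpha}$ (locally) that is constant on some neighbourhood of $0$, and let $\varphi_0\in\mathbb{R}$. Let $\varphi:\mathbb{H}\to\mathbb{R}$ be an admissible radial function of class $C^{4,\alpha}$ (locally) with $$F_2(\varphi)(x)=h(r(x))\ \text{ for all } x\in\mathbb{H},\qquad \varphi(o)=\varphi_0,$$ and let $f:[0,+\infty)\to\mathbb{R}$ be such that $\varphi(x)=f(r(x))$ for all $x\in\mathbb{H}$. Then: (i) if $h\le 1$ on $[0,+\infty)$, then $f$ is non-increasing; in particular, if $\varphi_0=0$, then $\varphi\le 0$ on $\mathbb{H}$; (ii) if $h\ge 1$ on $[0,+\infty)$, then $f$ is non-decreasing; in particular, if $\varphi_0=0$, then $\varphi\ge 0$ on $\mathbb{H}$. -/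

import Mathlib

open Set
open scoped NNReal

noncomputable section

/-- Minkowski space `ℝ^{n,1} = ℝⁿ × ℝ`; points are `X = (X', X_{n+1})`. -/
abbrev Minkowski (n : ℕ) : Type := EuclideanSpace ℝ (Fin n) × ℝ

namespace Minkowski

variable {n : ℕ}

/-- The Lorentzian scalar product `⟨X', Y'⟩ - X_{n+1} Y_{n+1}`. -/
def form (X Y : Minkowski n) : ℝ := inner ℝ X.1 Y.1 - X.2 * Y.2

end Minkowski

/-- The future unit hyperboloid `ℍ ⊂ ℝ^{n,1}`, the model of hyperbolic space. -/
def Hyperboloid (n : ℕ) : Type :=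
  {x : Minkowski n // Minkowski.form x x = -1 ∧ 0 < x.2}

namespace Hyperboloid

variable {n : ℕ}

/-- The hyperbolic distance of two points of `ℍ`: `cosh d(x, y) = -⟨x, y⟩`. -/
def hdist (x y : Hyperboloid n) : ℝ := Real.arcosh (-Minkowski.form x.1 y.1)

/-- The global chart `x = (x', x_{n+1}) ↦ x' ∈ ℝⁿ` of `ℍ`. -/
def chart (x : Hyperboloid n) : EuclideanSpace ℝ (Fin n) := x.1.1

/-- The inverse of the global chart: `x' ↦ (x', √(1 + |x'|²))`. -/
def ofChart (p : EuclideanSpace ℝ (Fin n)) : Hyperboloid n :=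
  ⟨(p, √(1 + ‖p‖ ^ 2)), by
    have h : (0 : ℝ) < 1 + ‖p‖ ^ 2 := by positivity
    refine ⟨?_, Real.sqrt_pos.2 h⟩
    simp only [Minkowski.form, real_inner_self_eq_norm_sq, Real.mul_self_sqrt h.le]
    ring⟩

@[simp] theorem chart_ofChart (p : EuclideanSpace ℝ (Fin n)) : chart (ofChart p) = p := rfl

@[simp] theorem ofChart_chart (x : Hyperboloid n) : ofChart (chart x) = x := by
  obtain ⟨⟨p, t⟩, h, ht⟩ := x
  apply Subtype.ext
  simp only [Minkowski.form, real_inner_self_eq_norm_sq] at h ht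
  simp only [ofChart, chart, Prod.mk.injEq, true_and]
  rw [show 1 + ‖p‖ ^ 2 = t ^ 2 by linarith, Real.sqrt_sq ht.le]

end Hyperboloid

/-- `g` is of class `C^{k,α}` on `s` (locally): it is `C^k` on `s` and its `k`-th derivative is
`α`-Hölder continuous on every compact subset of `s`. -/
def HolderClassOn {E : Type*} [NormedAddCommGroup E] [NormedSpace ℝ E]
    (k : ℕ) (α : ℝ≥0) (g : E → ℝ) (s : Set E) : Prop :=
  ContDiffOn ℝ k g s ∧
    ∀ K : Set E, K ⊆ s → IsCompact K →
      ∃ C : ℝ≥0, HolderOnWith C α (iteratedFDerivWithin ℝ k g s) K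

namespace RadialGraph

variable {n : ℕ}

/-- `φ : ℍ → ℝ` is of class `C^{k,α}`, read in the global chart of `ℍ`. -/
def IsHolderClass (k : ℕ) (α : ℝ≥0) (φ : Hyperboloid n → ℝ) : Prop :=
  HolderClassOn k α (fun p => φ (Hyperboloid.ofChart p)) univ

/-- The embedding `x ↦ e^{φ(x)} x` of `ℍ` onto the radial graph of `φ`, read in the global
chart of `ℍ`. -/
def embedding (φ : Hyperboloid n → ℝ) (p : EuclideanSpace ℝ (Fin n)) : Minkowski n :=
  Real.exp (φ (Hyperboloid.ofChart p)) • (Hyperboloid.ofChart p).1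

/-- The radial graph of `φ` is spacelike: the metric induced on it is positive definite. -/
def IsSpacelike (φ : Hyperboloid n → ℝ) : Prop :=
  ∀ p v : EuclideanSpace ℝ (Fin n), v ≠ 0 →
    0 < Minkowski.form (fderiv ℝ (embedding φ) p v) (fderiv ℝ (embedding φ) p v)

/-- `N` is a future oriented unit normal vector to the radial graph of `φ` at the image
of `p`. It exists and is unique if the graph is spacelike. -/
def IsFutureUnitNormal (φ : Hyperboloid n → ℝ) (p : EuclideanSpace ℝ (Fin n))
    (N : Minkowski n) : Prop :=
  (∀ v, Minkowski.form N (fderiv ℝ (embedding φ) p v) = 0) ∧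
    Minkowski.form N N = -1 ∧ 0 < N.2

/-- The future oriented unit normal field of the radial graph of `φ`, as a map on the chart. -/
def normal (φ : Hyperboloid n → ℝ) (p : EuclideanSpace ℝ (Fin n)) : Minkowski n :=
  Classical.epsilon (IsFutureUnitNormal φ p)

/-- The curvature endomorphism `S = dN` of the radial graph of `φ`. The tangent space of the graph
at the image of `p` is identified with `ℝⁿ` by the differential of the embedding `X`, so that
`S` is the endomorphism of `ℝⁿ` with `dX (S v) = dN v`. -/
def curvatureEndo (φ : Hyperboloid n → ℝ) (p : EuclideanSpace ℝ (Fin n)) :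
    EuclideanSpace ℝ (Fin n) →ₗ[ℝ] EuclideanSpace ℝ (Fin n) :=
  Classical.epsilon fun S => ∀ v, fderiv ℝ (embedding φ) p (S v) = fderiv ℝ (normal φ) p v

/-- The principal curvatures of the radial graph of `φ` at the point `e^{φ(x)} x`: the eigenvalues
of the curvature endomorphism, with multiplicity. -/
def principalCurvatures (φ : Hyperboloid n → ℝ) (x : Hyperboloid n) : Multiset ℝ :=
  (curvatureEndo φ x.chart).charpoly.roots

/-- The `m`-th mean curvature `H_m = σ_m(κ₁, …, κₙ)` at the point `e^{φ(x)} x`. -/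
def meanCurvature (m : ℕ) (φ : Hyperboloid n → ℝ) (x : Hyperboloid n) : ℝ :=
  (principalCurvatures φ x).esymm m

/-- `φ` is `m`-admissible: its radial graph is spacelike and its principal curvatures lie everywhere
in the cone `Γ_m = {κ : σ_i(κ) > 0, i = 1, …, m}`. -/
def IsAdmissible (m : ℕ) (φ : Hyperboloid n → ℝ) : Prop :=
  IsSpacelike φ ∧ ∀ x : Hyperboloid n, ∀ i ∈ Finset.Icc 1 m, 0 < meanCurvature i φ x

/-- The radial operator `F_m(φ) = e^φ [H_m / (n choose m)]^{1/m}`. -/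
def F (m : ℕ) (φ : Hyperboloid n → ℝ) (x : Hyperboloid n) : ℝ :=
  Real.exp (φ x) * (meanCurvature m φ x / (n.choose m : ℝ)) ^ ((1 : ℝ) / (m : ℝ))

end RadialGraph

end

/-!
The proof reduces the equation `F₂(φ) = h` to an ordinary differential equation along a geodesic and
reads off the sign of `f''` at the points where `f'` has the wrong sign.

Write `c = cosh r = -⟨o, x⟩` and `φ = G(c)`. Away from `o` the future unit normal of the radial graph
is an explicit combination of `x` and `o` (`RadialGraph.normal_eq`), so `dN` is a homothety on the
directions tangent to geodesic spheres plus a rank one term in the radial direction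
(`RadialGraph.curvatureEndo_eq`). The principal curvatures are therefore `e^{-f} A`, of multiplicity
`n - 1`, and `e^{-f} B`, where, with `p = f'`,
`A = (1 + p coth r) / √(1 - p²)` and `B = (1 - p²)^(-1/2) + (1 - p²)^(-3/2) p'`.
Admissibility gives `A > 0`, and the equation becomes `(n - 2) A² + 2 A B = n h²`
(`RadialGraph.radial_equation`).

* Let `h ≤ 1` and `p > 0` at some `r > 0`. Then `A > 1`, the equation forces `B < 1`, and hence
  `p' < 0` (`deriv_neg_of_curvature_le`).
* Let `h ≥ 1` and `p < 0` at some `r > 0`. Since `coth r > 1`, `A < √((1 + p) / (1 - p)) < 1`, the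
  equation forces `B ≥ 1 / A`, and hence `p' > 0` (`deriv_pos_of_le_curvature`).

The restriction of `φ` to a geodesic through `o` is a `C²` even function, so `p` extends to `r = 0`
by `p(0) = 0`. A function vanishing at `0` that decreases strictly wherever it is positive cannot
become positive (`nonpos_of_deriv_neg_of_pos`); applied to `p`, respectively `-p`, this gives the
sign of `f'`. The singularity of the equation at `r = 0` plays no role.
-/

noncomputable section

/-! ### A barrier argument and the radial ordinary differential inequality -/

/-- A function that vanishes at `0` and has negative derivative wherever it is positive never
becomes positive: it cannot cross any level `ε > 0` upwards. -/
theorem nonpos_of_deriv_neg_of_pos {u u' : ℝ → ℝ} (hu : ∀ r, HasDerivAt u (u' r) r)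
    (hu₀ : u 0 = 0) (hneg : ∀ r, 0 < r → 0 < u r → u' r < 0) {r : ℝ} (hr : 0 ≤ r) : u r ≤ 0 := by
  refine le_of_forall_pos_le_add fun ε hε => ?_
  have key := image_le_of_deriv_right_lt_deriv_boundary (f := u) (f' := u') (a := 0) (b := r)
    (B := fun _ => ε) (B' := fun _ => 0) (fun x _ => (hu x).continuousAt.continuousWithinAt)
    (fun x _ => (hu x).hasDerivWithinAt) (by rw [hu₀]; exact hε.le)
    (fun x => hasDerivAt_const x ε) ?_ (right_mem_Icc.2 hr)
  · simpa using key
  · intro x hx hxε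
    refine hneg x (lt_of_le_of_ne hx.1 ?_) (hxε ▸ hε)
    rintro rfl
    rw [hu₀] at hxε
    exact hε.ne hxε

/-- In the cone `σ₁, σ₂ > 0` a principal curvature of multiplicity `m + 1` is positive. -/
theorem pos_of_sigma_pos {m A B : ℝ} (hm : 0 ≤ m) (h₁ : 0 < (m + 1) * A + B)
    (h₂ : 0 < m * A ^ 2 + 2 * A * B) : 0 < A := by
  by_contra hA
  push Not at hA
  nlinarith [mul_nonneg hm (sq_nonneg A), mul_nonneg_of_nonpos_of_nonpos hA hA,
    mul_nonneg (neg_nonneg.2 hA) h₁.le]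

/-- With `p = f'` and `p' = f''`, the numbers `A` and `B` are the tangential and radial principal
curvatures of the radial graph, scaled by `e^f`; `k` is `coth r` and `m = n - 2`. -/
theorem deriv_neg_of_curvature_le {m p p' k w A B H : ℝ} (hm : 0 ≤ m) (hk : 1 < k) (hw : 0 < w)
    (hw2 : w ^ 2 = 1 - p ^ 2) (hA : A = (1 + p * k) / w) (hB : B = 1 / w + p' / w ^ 3)
    (heq : m * A ^ 2 + 2 * A * B = (m + 2) * H) (hH : H ≤ 1) (hp : 0 < p) : p' < 0 := by
  have hw1 : w < 1 := by nlinarith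
  have hA1 : 1 < A := by
    rw [hA, lt_div_iff₀ hw]
    nlinarith [mul_pos hp (by linarith : 0 < k)]
  have hB1 : B < 1 := by
    by_contra hB1
    push Not at hB1
    nlinarith [mul_nonneg hm (by nlinarith : 0 ≤ A ^ 2 - 1), mul_le_mul_of_nonneg_left hH
      (by linarith : 0 ≤ m + 2)]
  have : 1 < 1 / w := by rwa [lt_div_iff₀ hw, one_mul]
  have h3 : p' / w ^ 3 < 0 := by linarith
  by_contra hp'
  push Not at hp'
  exact absurd h3 (not_lt.2 (by positivity))

/-- The counterpart of `deriv_neg_of_curvature_le` for `p < 0`, where the sharp comparison of `A`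
with `√((1 + p) / (1 - p))` replaces the comparison with `1`. -/
theorem deriv_pos_of_le_curvature {m p p' k w A B H : ℝ} (hm : 0 ≤ m) (hk : 1 < k) (hw : 0 < w)
    (hw2 : w ^ 2 = 1 - p ^ 2) (hA : A = (1 + p * k) / w) (hB : B = 1 / w + p' / w ^ 3)
    (heq : m * A ^ 2 + 2 * A * B = (m + 2) * H) (hH : 1 ≤ H) (hA0 : 0 < A) (hp : p < 0) :
    0 < p' := by
  have hp1 : -1 < p := by nlinarith [sq_pos_of_pos hw]
  have hAw : A * w = 1 + p * k := by rw [hA]; field_simp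
  -- `A < (1 + p) / w = w / (1 - p)`, because `coth r > 1`
  have hA1 : A * w < 1 + p := by nlinarith
  have hAp : A * (1 - p) < w := by
    have : A * (1 - p) * w < w * w := by nlinarith
    exact lt_of_mul_lt_mul_right this hw.le
  have hw1 : w < 1 := by nlinarith
  have hA2 : A < 1 := by nlinarith
  have hAB : 1 ≤ A * B := by
    nlinarith [mul_nonneg hm (by nlinarith : 0 ≤ 1 - A ^ 2), mul_le_mul_of_nonneg_left hH
      (by linarith : 0 ≤ m + 2)]
  have hBw : B * w ^ 3 = w ^ 2 + p' := by rw [hB]; field_simp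
  -- `B ≥ 1 / A > (1 - p) / w`, hence `w ^ 2 + p' = B w ^ 3 > (1 - p) w ^ 2`
  have h1 : A * (1 - p) < A * (B * w) := by nlinarith
  have h2 : 1 - p < B * w := lt_of_mul_lt_mul_left h1 hA0.le
  nlinarith [sq_pos_of_pos hw, mul_lt_mul_of_pos_right h2 (sq_pos_of_pos hw)]

/-! ### The characteristic polynomial of a rank one perturbation of a homothety -/

open Polynomial in
/-- A linear endomorphism `k • id + ℓ ⊗ u` has the eigenvalue `k` with multiplicity `n - 1` and the
simple eigenvalue `k + ℓ u`. -/
theorem charpoly_roots_smul_id_add_smulRight {n : ℕ} (hn : 1 ≤ n) (k : ℝ)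
    (l : EuclideanSpace ℝ (Fin n) →ₗ[ℝ] ℝ) (u : EuclideanSpace ℝ (Fin n)) :
    (k • (LinearMap.id : EuclideanSpace ℝ (Fin n) →ₗ[ℝ] _) + l.smulRight u).charpoly.roots =
      (k + l u) ::ₘ Multiset.replicate (n - 1) k := by
  classical
  set b := (EuclideanSpace.basisFun (Fin n) ℝ).toBasis
  have hmat : LinearMap.toMatrix b b (l.smulRight u) =
      Matrix.vecMulVec (fun i => u i) (fun j => l (b j)) := by
    ext i j
    simp [LinearMap.toMatrix_apply, Matrix.vecMulVec_apply, b, mul_comm]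
  have hdot : (fun i => u i) ⬝ᵥ (fun j => l (b j)) = l u := by
    conv_rhs => rw [← b.sum_repr u, map_sum]
    simp [dotProduct, b]
  have hrank : (l.smulRight u).charpoly =
      (X : ℝ[X]) ^ n - (l u) • X ^ (n - 1) := by
    rw [← LinearMap.charpoly_toMatrix _ b, hmat, Matrix.charpoly_vecMulVec, hdot,
      Fintype.card_fin]
  have hchar : (k • (LinearMap.id : EuclideanSpace ℝ (Fin n) →ₗ[ℝ] _) + l.smulRight u).charpoly =
      (X - C (k + l u)) * (X - C k) ^ (n - 1) := by
    have h := LinearMap.charpoly_sub_smul (R := ℝ) (l.smulRight u) (-k)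
    have he : (k • (LinearMap.id : EuclideanSpace ℝ (Fin n) →ₗ[ℝ] _) + l.smulRight u) =
        (l.smulRight u) - (-k) • (1 : Module.End ℝ (EuclideanSpace ℝ (Fin n))) := by
      ext v; simp; ring
    rw [he, h, hrank]
    obtain ⟨m, rfl⟩ : ∃ m, n = m + 1 := ⟨n - 1, by omega⟩
    simp [smul_eq_C_mul, pow_succ]
    ring
  rw [hchar, roots_mul (mul_ne_zero (X_sub_C_ne_zero _) (pow_ne_zero _ (X_sub_C_ne_zero _))),
    roots_X_sub_C, roots_pow, roots_X_sub_C, Multiset.nsmul_singleton]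
  rfl

theorem esymm_one_cons_replicate (m : ℕ) (k b : ℝ) :
    (b ::ₘ Multiset.replicate m k).esymm 1 = m * k + b := by
  simp [Multiset.esymm, Multiset.powersetCard_one]

theorem esymm_two_cons_replicate (m : ℕ) (k b : ℝ) :
    (b ::ₘ Multiset.replicate m k).esymm 2 = m * (m - 1) / 2 * k ^ 2 + m * k * b := by
  have h1 : ∀ (j : ℕ) (d : ℝ), (d ::ₘ Multiset.replicate j k).esymm 2 =
      (Multiset.replicate j k).esymm 2 + d * (j * k) := by
    intro j d
    simp [Multiset.esymm, Multiset.powersetCard_cons, Multiset.powersetCard_one]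
    ring
  have h2 : ∀ j : ℕ, (Multiset.replicate j k).esymm 2 = j * (j - 1) / 2 * k ^ 2 := by
    intro j
    induction j with
    | zero => simp [Multiset.esymm, Multiset.powersetCard_zero_right]
    | succ j ih => rw [Multiset.replicate_succ, h1, ih]; push_cast; ring
  rw [h1, h2]; ring

/-! ### The Lorentzian form and the hyperboloid -/

namespace Minkowski

variable {n : ℕ}

theorem form_comm (X Y : Minkowski n) : form X Y = form Y X := by
  simp only [form, real_inner_comm]; ring

theorem form_add_left (X Y Z : Minkowski n) : form (X + Y) Z = form X Z + form Y Z := by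
  simp only [form, Prod.fst_add, Prod.snd_add, inner_add_left]; ring

theorem form_sub_left (X Y Z : Minkowski n) : form (X - Y) Z = form X Z - form Y Z := by
  simp only [form, Prod.fst_sub, Prod.snd_sub, inner_sub_left]; ring

theorem form_smul_left (t : ℝ) (X Z : Minkowski n) : form (t • X) Z = t * form X Z := by
  simp only [form, Prod.smul_fst, Prod.smul_snd, real_inner_smul_left, smul_eq_mul]; ring

theorem form_add_right (X Y Z : Minkowski n) : form Z (X + Y) = form Z X + form Z Y := by
  simp only [form_comm Z, form_add_left]

theorem form_sub_right (X Y Z : Minkowski n) : form Z (X - Y) = form Z X - form Z Y := by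
  simp only [form_comm Z, form_sub_left]

theorem form_smul_right (t : ℝ) (X Z : Minkowski n) : form Z (t • X) = t * form Z X := by
  simp only [form_comm Z, form_smul_left]

/-- The linear functional `⟨X, ·⟩`. -/
def formCLM (X : Minkowski n) : Minkowski n →L[ℝ] ℝ :=
  (innerSL ℝ X.1).comp (ContinuousLinearMap.fst ℝ _ _) - X.2 • ContinuousLinearMap.snd ℝ _ _

@[simp] theorem formCLM_apply (X Y : Minkowski n) : formCLM X Y = form X Y := by
  simp [formCLM, form]

/-- The reversed Cauchy–Schwarz inequality for future unit timelike vectors. -/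
theorem form_le_neg_one {X Y : Minkowski n} (hX : form X X = -1) (hX₀ : 0 < X.2)
    (hY : form Y Y = -1) (hY₀ : 0 < Y.2) : form X Y ≤ -1 := by
  simp only [form, real_inner_self_eq_norm_sq] at *
  have h := real_inner_le_norm X.1 Y.1
  have h1 : (1 + ‖X.1‖ * ‖Y.1‖) ^ 2 ≤ (X.2 * Y.2) ^ 2 := by
    have : (X.2 * Y.2) ^ 2 = (1 + ‖X.1‖ ^ 2) * (1 + ‖Y.1‖ ^ 2) := by
      rw [mul_pow, show X.2 ^ 2 = 1 + ‖X.1‖ ^ 2 by linarith,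
        show Y.2 ^ 2 = 1 + ‖Y.1‖ ^ 2 by linarith]
    nlinarith [sq_nonneg (‖X.1‖ - ‖Y.1‖)]
  have h2 := abs_le_of_sq_le_sq' h1 (by positivity)
  linarith [h2.2]

/-- A unit timelike vector lies in the future cone as soon as its product with one future unit
timelike vector is negative. -/
theorem snd_pos_of_form_neg {X Y : Minkowski n} (hX : form X X = -1) (hX₀ : 0 < X.2)
    (hY : form Y Y = -1) (h : form X Y < 0) : 0 < Y.2 := by
  by_contra hY₀
  push Not at hY₀
  have hne : Y.2 ≠ 0 := by
    intro h0
    simp only [form, real_inner_self_eq_norm_sq, h0] at hY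
    nlinarith [sq_nonneg ‖Y.1‖]
  have hYneg : form ((-1 : ℝ) • Y) ((-1 : ℝ) • Y) = -1 := by
    rw [form_smul_left, form_smul_right, hY]; norm_num
  have h1 := form_le_neg_one hX hX₀ hYneg (by
    simpa using lt_of_le_of_ne hY₀ hne)
  rw [form_smul_right] at h1
  linarith

end Minkowski

open Minkowski

namespace Hyperboloid

variable {n : ℕ}

theorem one_le_neg_form (x y : Hyperboloid n) : 1 ≤ -form x.1 y.1 := by
  linarith [form_le_neg_one x.2.1 x.2.2 y.2.1 y.2.2]

theorem hdist_nonneg (x y : Hyperboloid n) : 0 ≤ hdist x y :=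
  Real.arcosh_nonneg (one_le_neg_form x y)

theorem hdist_self (x : Hyperboloid n) : hdist x x = 0 := by
  simp [hdist, x.2.1]

/-- The differential of the inverse chart `p ↦ (p, √(1 + |p|²))`. -/
def dOfChart (p : EuclideanSpace ℝ (Fin n)) : EuclideanSpace ℝ (Fin n) →L[ℝ] Minkowski n :=
  (ContinuousLinearMap.id ℝ _).prod ((√(1 + ‖p‖ ^ 2))⁻¹ • innerSL ℝ p)

theorem hasFDerivAt_ofChart (p : EuclideanSpace ℝ (Fin n)) :
    HasFDerivAt (fun p => (ofChart p).1) (dOfChart p) p := by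
  have h : (1 + ‖p‖ ^ 2 : ℝ) ≠ 0 := by positivity
  have h1 : HasFDerivAt (fun p : EuclideanSpace ℝ (Fin n) => 1 + ‖p‖ ^ 2)
      (2 • innerSL ℝ p) p := by
    simpa using ((hasStrictFDerivAt_norm_sq p).hasFDerivAt).const_add 1
  have h2 := (hasFDerivAt_id p).prodMk (h1.sqrt h)
  have h3 : dOfChart p = (ContinuousLinearMap.id ℝ _).prod
      ((1 / (2 * √(1 + ‖p‖ ^ 2))) • (2 • innerSL ℝ p)) := by
    simp only [dOfChart]
    congr 1
    rw [← Nat.cast_smul_eq_nsmul ℝ, smul_smul]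
    congr 1
    push_cast
    field_simp
  rw [h3]
  exact h2

theorem form_dOfChart (p v : EuclideanSpace ℝ (Fin n)) :
    form (ofChart p).1 (dOfChart p v) = 0 := by
  have h : √(1 + ‖p‖ ^ 2) ≠ 0 := by positivity
  simp [form, dOfChart, ofChart, h]

/-- The tangent space of the hyperboloid at `x` is the orthogonal complement of `x`. -/
theorem dOfChart_fst {p : EuclideanSpace ℝ (Fin n)} {Y : Minkowski n}
    (hY : form (ofChart p).1 Y = 0) : dOfChart p Y.1 = Y := by
  have h : √(1 + ‖p‖ ^ 2) ≠ 0 := by positivity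
  simp only [form, ofChart] at hY
  refine Prod.ext rfl ?_
  simp only [dOfChart, ContinuousLinearMap.prod_apply, FunLike.coe_smul, Pi.smul_apply,
    innerSL_apply_apply, smul_eq_mul]
  field_simp
  linarith

theorem form_dOfChart_self_pos (p : EuclideanSpace ℝ (Fin n)) {v : EuclideanSpace ℝ (Fin n)}
    (hv : v ≠ 0) : 0 < form (dOfChart p v) (dOfChart p v) := by
  have h : (0 : ℝ) < 1 + ‖p‖ ^ 2 := by positivity
  have hv' : 0 < ‖v‖ ^ 2 := by positivity
  have hs : (√(1 + ‖p‖ ^ 2))⁻¹ * (√(1 + ‖p‖ ^ 2))⁻¹ = (1 + ‖p‖ ^ 2)⁻¹ := by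
    rw [← mul_inv, Real.mul_self_sqrt h.le]
  have hcs : (inner ℝ p v) ^ 2 ≤ ‖p‖ ^ 2 * ‖v‖ ^ 2 := by
    rw [← mul_pow]; exact sq_le_sq' (by linarith [abs_le.1 (abs_real_inner_le_norm p v)])
      (real_inner_le_norm p v)
  have he : form (dOfChart p v) (dOfChart p v) =
      ‖v‖ ^ 2 - (1 + ‖p‖ ^ 2)⁻¹ * (inner ℝ p v) ^ 2 := by
    simp only [form, dOfChart, ContinuousLinearMap.prod_apply, FunLike.coe_smul, Pi.smul_apply,
      innerSL_apply_apply, smul_eq_mul, ContinuousLinearMap.id_apply, real_inner_self_eq_norm_sq,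
      ← hs]
    ring
  rw [he, sub_pos, inv_mul_lt_iff₀ h]
  nlinarith

/-- The differential of `x ↦ -⟨o, x⟩ = cosh (hdist o x)` in the chart. -/
def dCosh (o : Hyperboloid n) (p : EuclideanSpace ℝ (Fin n)) :
    EuclideanSpace ℝ (Fin n) →L[ℝ] ℝ :=
  -(formCLM o.1).comp (dOfChart p)

theorem dCosh_apply (o : Hyperboloid n) (p v : EuclideanSpace ℝ (Fin n)) :
    dCosh o p v = -form o.1 (dOfChart p v) := by simp [dCosh]

theorem hasFDerivAt_neg_form (o : Hyperboloid n) (p : EuclideanSpace ℝ (Fin n)) :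
    HasFDerivAt (fun p => -form o.1 (ofChart p).1) (dCosh o p) p := by
  have h := ((formCLM o.1).hasFDerivAt.comp p (hasFDerivAt_ofChart p)).fun_neg
  simp only [Function.comp_def, formCLM_apply] at h
  exact h

/-- The vector, in the chart, of the radial field `sinh r ∂ᵣ = cosh r x - o`. -/
def radialVec (o : Hyperboloid n) (p : EuclideanSpace ℝ (Fin n)) : EuclideanSpace ℝ (Fin n) :=
  ((-form o.1 (ofChart p).1) • (ofChart p).1 - o.1).1

theorem dOfChart_radialVec (o : Hyperboloid n) (p : EuclideanSpace ℝ (Fin n)) :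
    dOfChart p (radialVec o p) = (-form o.1 (ofChart p).1) • (ofChart p).1 - o.1 := by
  refine dOfChart_fst ?_
  rw [form_sub_right, form_smul_right, (ofChart p).2.1, form_comm o.1]; ring

theorem dCosh_radialVec (o : Hyperboloid n) (p : EuclideanSpace ℝ (Fin n)) :
    dCosh o p (radialVec o p) = (form o.1 (ofChart p).1) ^ 2 - 1 := by
  rw [dCosh_apply, dOfChart_radialVec, form_sub_right, form_smul_right, o.2.1]; ring

end Hyperboloid

/-! ### The geometry of the radial graph of a radial function -/

namespace RadialGraph

open Hyperboloid

variable {n : ℕ} {o : Hyperboloid n} {φ : Hyperboloid n → ℝ} {G : ℝ → ℝ}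

/-- For `φ = G (cosh r)`, the square `1 - |∇φ|²` as a function of `c = cosh r` and `q = G' c`. -/
def lapseSq (c q : ℝ) : ℝ := 1 - (c ^ 2 - 1) * q ^ 2

theorem hasFDerivAt_embedding (hφ : ∀ x, φ x = G (-form o.1 x.1))
    {p : EuclideanSpace ℝ (Fin n)} {q : ℝ} (hq : HasDerivAt G q (-form o.1 (ofChart p).1)) :
    HasFDerivAt (embedding φ) (Real.exp (φ (ofChart p)) •
      (dOfChart p + q • (dCosh o p).smulRight (ofChart p).1)) p := by
  have h1 := (hq.comp_hasFDerivAt p (hasFDerivAt_neg_form o p)).exp.smul (hasFDerivAt_ofChart p)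
  have h2 : embedding φ = fun p => Real.exp (G (-form o.1 (ofChart p).1)) • (ofChart p).1 := by
    funext p; rw [embedding, hφ]
  have h3 : Real.exp (φ (ofChart p)) • (dOfChart p + q • (dCosh o p).smulRight (ofChart p).1) =
      Real.exp (G (-form o.1 (ofChart p).1)) • dOfChart p +
        (Real.exp (G (-form o.1 (ofChart p).1)) • (q • dCosh o p)).smulRight (ofChart p).1 := by
    rw [hφ]
    ext v : 1
    simp only [FunLike.coe_smul, Pi.smul_apply, FunLike.coe_add, Pi.add_apply,
      ContinuousLinearMap.smulRight_apply, smul_eq_mul, smul_add, smul_smul]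
  rw [h2, h3]
  exact h1

theorem fderiv_embedding_apply (hφ : ∀ x, φ x = G (-form o.1 x.1))
    {p : EuclideanSpace ℝ (Fin n)} {q : ℝ} (hq : HasDerivAt G q (-form o.1 (ofChart p).1))
    (v : EuclideanSpace ℝ (Fin n)) :
    fderiv ℝ (embedding φ) p v = Real.exp (φ (ofChart p)) •
      (dOfChart p v + (q * dCosh o p v) • (ofChart p).1) := by
  rw [(hasFDerivAt_embedding hφ hq).fderiv]
  simp only [FunLike.coe_smul, Pi.smul_apply, FunLike.coe_add, Pi.add_apply,
      ContinuousLinearMap.smulRight_apply, smul_smul]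

/-- The graph is spacelike only if `|∇φ| < 1`: test the metric on the radial direction. -/
theorem lapseSq_pos (hs : IsSpacelike φ) (hφ : ∀ x, φ x = G (-form o.1 x.1))
    {p : EuclideanSpace ℝ (Fin n)} {q c : ℝ} (hc : c = -form o.1 (ofChart p).1)
    (hq : HasDerivAt G q c) (hc1 : 1 < c) : 0 < lapseSq c q := by
  have hdv : dCosh o p (radialVec o p) = c ^ 2 - 1 := by rw [dCosh_radialVec, hc]; ring
  have hd : dOfChart p (radialVec o p) = c • (ofChart p).1 - o.1 := by
    rw [dOfChart_radialVec, hc]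
  have hc2 : 0 < c ^ 2 - 1 := by nlinarith
  have hne : radialVec o p ≠ 0 := by
    intro h0
    rw [h0, map_zero] at hdv
    exact hc2.ne hdv
  have ho : form o.1 (ofChart p).1 = -c := by linarith
  have key := hs p _ hne
  rw [fderiv_embedding_apply hφ (hc ▸ hq), hdv, hd, form_smul_left, form_smul_right] at key
  simp only [form_add_left, form_add_right, form_sub_left, form_sub_right, form_smul_left,
    form_smul_right, form_comm _ o.1, ho, o.2.1, (ofChart p).2.1] at key
  have h1 := (mul_pos_iff_of_pos_left (Real.exp_pos _)).1
    ((mul_pos_iff_of_pos_left (Real.exp_pos _)).1 key)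
  have h2 : 0 < (c ^ 2 - 1) * lapseSq c q := by
    refine h1.trans_eq ?_
    rw [lapseSq]; ring
  exact (mul_pos_iff_of_pos_left hc2).1 h2

/-- The future unit normal `(1 - |∇φ|²)^(-1/2) (x + ∇φ)` of the graph of `φ = G (cosh r)`, in terms
of `x` and `o`. -/
theorem normal_eq (hs : IsSpacelike φ) (hφ : ∀ x, φ x = G (-form o.1 x.1))
    {p : EuclideanSpace ℝ (Fin n)} {q c : ℝ} (hc : c = -form o.1 (ofChart p).1)
    (hq : HasDerivAt G q c) (hc1 : 1 < c) :
    normal φ p = ((1 + c * q) / √(lapseSq c q)) • (ofChart p).1 - (q / √(lapseSq c q)) • o.1 := by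
  have hW := lapseSq_pos hs hφ hc hq hc1
  set w := √(lapseSq c q) with hw
  have hw0 : 0 < w := Real.sqrt_pos.2 hW
  have hw2 : w ^ 2 = 1 - (c ^ 2 - 1) * q ^ 2 := Real.sq_sqrt hW.le
  set x := (ofChart p).1 with hx
  set N₀ := ((1 + c * q) / w) • x - (q / w) • o.1 with hN₀
  have hox : form o.1 x = -c := by linarith
  have hxx : form x x = -1 := (ofChart p).2.1
  have hdX := fun v => fderiv_embedding_apply hφ (hc ▸ hq) v
  have hortho : ∀ v, form N₀ (fderiv ℝ (embedding φ) p v) = 0 := by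
    intro v
    have h1 : form x (dOfChart p v) = 0 := form_dOfChart p v
    have h2 : form o.1 (dOfChart p v) = -dCosh o p v := by rw [dCosh_apply]; ring
    rw [hdX, hN₀]
    simp only [← hx, form_sub_left, form_smul_left, form_smul_right, form_add_right, hox, hxx,
      h1, h2]
    field_simp
    ring
  have hNx : form N₀ x = -(1 / w) := by
    simp only [hN₀, form_sub_left, form_smul_left, hox, hxx]
    field_simp
    ring
  have hNN : form N₀ N₀ = -1 := by
    have hNo : form N₀ o.1 = (-c - (c ^ 2 - 1) * q) / w := by
      simp only [hN₀, form_sub_left, form_smul_left, form_comm x o.1, hox, o.2.1]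
      field_simp
      ring
    have : form N₀ N₀ = (1 + c * q) / w * form N₀ x - q / w * form N₀ o.1 := by
      conv_lhs => rw [hN₀]
      rw [form_sub_right, form_smul_right, form_smul_right]
    rw [this, hNx, hNo]
    field_simp
    rw [hw2]
    ring
  have hfut : 0 < N₀.2 := by
    refine snd_pos_of_form_neg hxx (ofChart p).2.2 hNN ?_
    rw [form_comm, hNx]
    exact neg_neg_of_pos (by positivity)
  have hspec : IsFutureUnitNormal φ p (normal φ p) :=
    Classical.epsilon_spec (p := IsFutureUnitNormal φ p) ⟨N₀, hortho, hNN, hfut⟩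
  -- Uniqueness: the component `Z` of the normal orthogonal to `N₀` is tangent to the graph, and
  -- orthogonal to the tangent space, hence vanishes.
  set N := normal φ p with hN
  set Z := N + form N N₀ • N₀ with hZ
  have hZN : form N₀ Z = 0 := by
    rw [hZ, form_add_right, form_smul_right, hNN, form_comm N₀ N]; ring
  set Y := Real.exp (-φ (ofChart p)) • (Z + form x Z • x) with hY
  have hxY : form x Y = 0 := by
    rw [hY, form_smul_right, form_add_right, form_smul_right, hxx]; ring
  have hdY : dOfChart p Y.1 = Y := dOfChart_fst hxY
  obtain ⟨t, ht⟩ : ∃ t : ℝ, fderiv ℝ (embedding φ) p Y.1 = Z + t • x := by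
    refine ⟨form x Z + Real.exp (φ (ofChart p)) * (q * dCosh o p Y.1), ?_⟩
    rw [hdX, hdY, smul_add]
    nth_rw 1 [hY]
    rw [smul_smul, ← Real.exp_add, add_neg_cancel, Real.exp_zero, one_smul, smul_smul, add_assoc,
      ← add_smul]
  have ht0 : t = 0 := by
    have h1 := hortho Y.1
    rw [ht, form_add_right, form_smul_right, hZN, hNx] at h1
    have : t * (1 / w) = 0 := by linarith
    exact (mul_eq_zero.1 this).resolve_right (by positivity)
  rw [ht0, zero_smul, add_zero] at ht
  have hZZ : form Z Z = 0 := by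
    have h1 := hspec.1 Y.1
    rw [ht] at h1
    nth_rw 1 [hZ]
    rw [form_add_left, form_smul_left, h1, hZN]; ring
  have hY0 : Y.1 = 0 := by
    by_contra h0
    have h1 := hs p _ h0
    rw [ht, hZZ] at h1
    exact h1.false
  rw [hY0, map_zero] at ht
  have hNl : N = (-form N N₀) • N₀ := by
    rw [neg_smul]; exact eq_neg_of_add_eq_zero_left (hZ ▸ ht.symm)
  have hsq : (-form N N₀) ^ 2 = 1 := by
    have h1 := hspec.2.1
    rw [hNl, form_smul_left, form_smul_right, hNN] at h1
    nlinarith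
  have hpos : 0 < -form N N₀ := by
    have h1 := hspec.2.2
    rw [hNl] at h1
    exact (pos_iff_pos_of_mul_pos h1).2 hfut
  rw [hNl, show -form N N₀ = 1 by nlinarith, one_smul]

theorem injective_fderiv_embedding (hs : IsSpacelike φ) (p : EuclideanSpace ℝ (Fin n)) :
    Function.Injective (fderiv ℝ (embedding φ) p) := by
  rw [injective_iff_map_eq_zero]
  intro v hv
  by_contra h0
  have h1 := hs p v h0
  rw [hv] at h1
  simp [form] at h1

/-- The curvature endomorphism of the graph of `φ = G (cosh r)` is a homothety on the directions
tangent to the geodesic sphere, plus a rank one term in the radial direction. -/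
theorem curvatureEndo_eq (hs : IsSpacelike φ) (hφ : ∀ x, φ x = G (-form o.1 x.1))
    {G' : ℝ → ℝ} (hG : ∀ c, 1 < c → HasDerivAt G (G' c) c)
    {p : EuclideanSpace ℝ (Fin n)} {c q' : ℝ} (hc : c = -form o.1 (ofChart p).1) (hc1 : 1 < c)
    (hG' : HasDerivAt G' q' c) :
    curvatureEndo φ p =
      (Real.exp (-φ (ofChart p)) * ((1 + c * G' c) / √(lapseSq c (G' c)))) • LinearMap.id +
      ((Real.exp (-φ (ofChart p)) * ((q' + c * G' c ^ 3) / √(lapseSq c (G' c)) ^ 3)) •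
        (dCosh o p : EuclideanSpace ℝ (Fin n) →ₗ[ℝ] ℝ)).smulRight (radialVec o p) := by
  have hW := lapseSq_pos hs hφ hc (hG c hc1) hc1
  set q := G' c with hq
  set w := √(lapseSq c q) with hw
  have hw0 : 0 < w := Real.sqrt_pos.2 hW
  have hw2 : w ^ 2 = 1 - (c ^ 2 - 1) * q ^ 2 := Real.sq_sqrt hW.le
  have hinv : HasDerivAt (fun c => (√(lapseSq c (G' c)))⁻¹)
      ((c * q ^ 2 + (c ^ 2 - 1) * q * q') / w ^ 3) c := by
    have h1 : HasDerivAt (fun c => lapseSq c (G' c))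
        (-(2 * c * q ^ 2 + (c ^ 2 - 1) * (2 * q * q'))) c := by
      have := ((((hasDerivAt_id c).pow 2).sub_const 1).mul (hG'.pow 2)).const_sub 1
      refine this.congr_deriv ?_
      simp [← hq]
    have h2 := (h1.sqrt hW.ne').inv hw0.ne'
    refine h2.congr_deriv ?_
    rw [← hq, ← hw]
    field_simp
  -- derivatives of the coefficients of `o` and `x` in the normal
  have hb : HasDerivAt (fun c => G' c / √(lapseSq c (G' c))) ((q' + c * q ^ 3) / w ^ 3) c := by
    have h2 := hG'.mul hinv
    refine h2.congr_deriv ?_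
    rw [← hq, ← hw]
    field_simp
    rw [hw2]
    ring
  have ha : HasDerivAt (fun c => (1 + c * G' c) / √(lapseSq c (G' c)))
      ((1 + c * q) / w * q + (q' + c * q ^ 3) / w ^ 3 * (c + (c ^ 2 - 1) * q)) c := by
    have h2 := (((hasDerivAt_id c).mul hG').const_add 1).mul hinv
    refine h2.congr_deriv ?_
    simp only [id_eq, Pi.mul_apply, ← hq, ← hw]
    field_simp
    rw [hw2]
    ring
  have hcd := hasFDerivAt_neg_form o p
  have hev : normal φ =ᶠ[nhds p] fun p =>
      ((1 + (-form o.1 (ofChart p).1) * G' (-form o.1 (ofChart p).1)) /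
        √(lapseSq (-form o.1 (ofChart p).1) (G' (-form o.1 (ofChart p).1)))) • (ofChart p).1 -
      (G' (-form o.1 (ofChart p).1) /
        √(lapseSq (-form o.1 (ofChart p).1) (G' (-form o.1 (ofChart p).1)))) • o.1 := by
    have h1 := hcd.continuousAt.eventually_const_lt (by rwa [← hc] : 1 < -form o.1 (ofChart p).1)
    filter_upwards [h1] with p' hp'
    exact normal_eq hs hφ rfl (hG _ hp') hp'
  rw [hc] at ha hb
  have hN := ((ha.comp_hasFDerivAt p hcd).smul (hasFDerivAt_ofChart p)).sub
    ((hb.comp_hasFDerivAt p hcd).smul_const o.1)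
  have hdN := (hev.fderiv_eq.trans hN.fderiv)
  rw [← hc] at hdN
  -- The formula solves `dX ∘ S = dN`; as `dX` is injective, it is the only solution.
  have hS : ∀ v, fderiv ℝ (embedding φ) p
      (((Real.exp (-φ (ofChart p)) * ((1 + c * q) / w)) • LinearMap.id +
      ((Real.exp (-φ (ofChart p)) * ((q' + c * q ^ 3) / w ^ 3)) •
        (dCosh o p : EuclideanSpace ℝ (Fin n) →ₗ[ℝ] ℝ)).smulRight (radialVec o p) :
          EuclideanSpace ℝ (Fin n) →ₗ[ℝ] EuclideanSpace ℝ (Fin n)) v) =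
      fderiv ℝ (normal φ) p v := by
    intro v
    have hdv : dCosh o p (radialVec o p) = c ^ 2 - 1 := by rw [dCosh_radialVec, hc]; ring
    have hd : dOfChart p (radialVec o p) = c • (ofChart p).1 - o.1 := by
      rw [dOfChart_radialVec, hc]
    have hE : Real.exp (-φ (ofChart p)) * Real.exp (φ (ofChart p)) = 1 := by
      rw [← Real.exp_add, neg_add_cancel, Real.exp_zero]
    have hX := fun v => fderiv_embedding_apply hφ (p := p) (q := q) (hc ▸ hG c hc1) v
    rw [hdN]
    simp only [LinearMap.add_apply, LinearMap.smul_apply, LinearMap.id_apply,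
      LinearMap.smulRight_apply, ContinuousLinearMap.coe_coe, map_add, map_smul,
      hX, ← hc, hdv, hd, ← hq, ← hw, FunLike.coe_add,
      FunLike.coe_sub, FunLike.coe_smul, Pi.add_apply, Pi.sub_apply, Pi.smul_apply,
      ContinuousLinearMap.smulRight_apply, smul_eq_mul, Function.comp_apply]
    match_scalars
    · linear_combination ((1 + c * q) / w) * hE
    · linear_combination (((1 + c * q) / w * q + (q' + c * q ^ 3) / w ^ 3 * (c + (c ^ 2 - 1) * q)) *
        dCosh o p v) * hE
    · linear_combination (-((q' + c * q ^ 3) / w ^ 3) * dCosh o p v) * hE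
  have hspec := Classical.epsilon_spec (p := fun S : EuclideanSpace ℝ (Fin n) →ₗ[ℝ]
    EuclideanSpace ℝ (Fin n) => ∀ v, fderiv ℝ (embedding φ) p (S v) = fderiv ℝ (normal φ) p v)
    ⟨_, hS⟩
  refine LinearMap.ext fun v => injective_fderiv_embedding hs p ?_
  rw [hS v]
  exact hspec v

/-- The graph of a radial function has a simple principal curvature in the radial direction and one
of multiplicity `n - 1` along the geodesic spheres. -/
theorem principalCurvatures_eq (hn : 1 ≤ n) (hs : IsSpacelike φ)
    (hφ : ∀ x, φ x = G (-form o.1 x.1)) {G' : ℝ → ℝ} (hG : ∀ c, 1 < c → HasDerivAt G (G' c) c)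
    {x : Hyperboloid n} {c q' : ℝ} (hc : c = -form o.1 x.1) (hc1 : 1 < c)
    (hG' : HasDerivAt G' q' c) :
    principalCurvatures φ x =
      (Real.exp (-φ x) * ((1 + c * G' c) / √(lapseSq c (G' c)) +
        (c ^ 2 - 1) * ((q' + c * G' c ^ 3) / √(lapseSq c (G' c)) ^ 3))) ::ₘ
      Multiset.replicate (n - 1) (Real.exp (-φ x) * ((1 + c * G' c) / √(lapseSq c (G' c)))) := by
  rw [principalCurvatures, curvatureEndo_eq hs hφ hG (p := x.chart) (by rwa [ofChart_chart]) hc1 hG',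
    charpoly_roots_smul_id_add_smulRight hn]
  congr 1
  · rw [LinearMap.smul_apply, ContinuousLinearMap.coe_coe, dCosh_radialVec, ofChart_chart, hc,
      smul_eq_mul]
    ring
  · rw [ofChart_chart]

end RadialGraph

/-! ### The equation along a geodesic through the centre -/

open Hyperboloid RadialGraph

/-- A unit speed geodesic through `o`, of class `C²` in the chart. -/
theorem Hyperboloid.exists_geodesic {n : ℕ} (hn : 1 ≤ n) (o : Hyperboloid n) :
    ∃ γ : ℝ → Hyperboloid n, (∀ r, form o.1 (γ r).1 = -Real.cosh r) ∧
      ContDiff ℝ 2 fun r => (γ r).chart := by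
  have : Nonempty (Fin n) := ⟨⟨0, hn⟩⟩
  obtain ⟨v, hv⟩ := exists_ne (0 : EuclideanSpace ℝ (Fin n))
  have hs := form_dOfChart_self_pos o.chart hv
  set Y := dOfChart o.chart v with hY
  set e := (√(form Y Y))⁻¹ • Y with he
  have hoe : form o.1 e = 0 := by
    have := form_dOfChart o.chart v
    rw [ofChart_chart] at this
    rw [he, form_smul_right, this, mul_zero]
  have hee : form e e = 1 := by
    rw [he, form_smul_left, form_smul_right, ← mul_assoc, ← mul_inv, Real.mul_self_sqrt hs.le,
      inv_mul_cancel₀ hs.ne']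
  have hform : ∀ r, form o.1 (Real.cosh r • o.1 + Real.sinh r • e) = -Real.cosh r := by
    intro r
    rw [form_add_right, form_smul_right, form_smul_right, hoe, o.2.1]; ring
  have hmem : ∀ r, form (Real.cosh r • o.1 + Real.sinh r • e)
      (Real.cosh r • o.1 + Real.sinh r • e) = -1 := by
    intro r
    rw [form_add_left, form_smul_left, hform, form_smul_left, form_add_right, form_smul_right,
      form_smul_right, hee, form_comm e, hoe]
    linear_combination -Real.cosh_sq r
  refine ⟨fun r => ⟨Real.cosh r • o.1 + Real.sinh r • e, hmem r,
    snd_pos_of_form_neg o.2.1 o.2.2 (hmem r) ?_⟩, hform, ?_⟩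
  · rw [hform]; exact neg_neg_of_pos (Real.cosh_pos r)
  · exact contDiff_fst.comp ((Real.contDiff_cosh.smul contDiff_const).add
      (Real.contDiff_sinh.smul contDiff_const))

/-- Let `g` be the restriction of a radial admissible function to a geodesic through `o`. At `r > 0`,
with `p = g'`, the equation `F₂ = h` becomes `(n - 2) A² + 2 A B = n h²`, where
`A = (1 + p coth r) / √(1 - p²) > 0` and `B = (1 - p²)^(-1/2) + (1 - p²)^(-3/2) p'`. -/
theorem RadialGraph.radial_equation {n : ℕ} (hn : 2 ≤ n) {o : Hyperboloid n}
    {φ : Hyperboloid n → ℝ} (φ_adm : IsAdmissible 2 φ) {g : ℝ → ℝ} (hg : ContDiff ℝ 2 g)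
    (hφ : ∀ x, φ x = g (hdist o x)) {x : Hyperboloid n} {r H : ℝ} (hr : 0 < r)
    (hx : form o.1 x.1 = -Real.cosh r) (heq : F 2 φ x = H) :
    ∃ w A B : ℝ, 0 < w ∧ w ^ 2 = 1 - deriv g r ^ 2 ∧ 0 < A ∧
      A = (1 + deriv g r * (Real.cosh r / Real.sinh r)) / w ∧
      B = 1 / w + deriv (deriv g) r / w ^ 3 ∧
      ((n : ℝ) - 2) * A ^ 2 + 2 * A * B = ((n : ℝ) - 2 + 2) * H ^ 2 := by
  have hd1 : ∀ t, HasDerivAt g (deriv g t) t := fun t =>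
    (hg.differentiable (by norm_num) t).hasDerivAt
  have hd2 : ∀ t, HasDerivAt (deriv g) (deriv (deriv g) t) t := fun t =>
    (((contDiff_succ_iff_deriv (n := 1)).1 hg).2.2.differentiable (by norm_num) t).hasDerivAt
  set G := fun c => g (Real.arcosh c) with hGdef
  set G' := fun c => deriv g (Real.arcosh c) * (√(c ^ 2 - 1))⁻¹ with hG'def
  have hφG : ∀ x, φ x = G (-form o.1 x.1) := hφ
  have hG : ∀ c, 1 < c → HasDerivAt G (G' c) c := fun c hc =>
    (hd1 _).comp c (Real.hasDerivAt_arcosh hc)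
  set c := Real.cosh r with hc
  set s := Real.sinh r with hs
  have hs0 : 0 < s := Real.sinh_pos_iff.2 hr
  have hcs : c ^ 2 = s ^ 2 + 1 := Real.cosh_sq r
  have hc1 : 1 < c := Real.one_lt_cosh.2 hr.ne'
  have hsqrt : √(c ^ 2 - 1) = s := by
    rw [hcs, add_sub_cancel_right, Real.sqrt_sq hs0.le]
  have har : Real.arcosh c = r := Real.arcosh_cosh hr.le
  set p := deriv g r with hp
  set p' := deriv (deriv g) r with hp'
  have hq : G' c = p / s := by simp only [hG'def, har, hsqrt]; rw [div_eq_mul_inv]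
  have hG' : HasDerivAt G' ((p' - p * c / s) / s ^ 2) c := by
    have hc2 : c ^ 2 - 1 ≠ 0 := by rw [hcs]; simp [hs0.ne']
    have h1 : HasDerivAt (fun c : ℝ => (√(c ^ 2 - 1))⁻¹) (-(c / s) / s ^ 2) c := by
      have h := ((((hasDerivAt_id c).pow 2).sub_const 1).sqrt hc2).inv
        (by rw [show (id ^ 2) c - 1 = c ^ 2 - 1 from rfl, hsqrt]; exact hs0.ne')
      refine h.congr_deriv ?_
      simp only [Pi.pow_apply, id_eq, hsqrt]
      field_simp
      norm_num
    have h2 := ((hd2 (Real.arcosh c)).comp c (Real.hasDerivAt_arcosh hc1)).mul h1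
    refine h2.congr_deriv ?_
    simp only [Function.comp_apply, har, hsqrt]
    field_simp
    ring
  have hxc : c = -form o.1 x.1 := by rw [hx, neg_neg]
  have hκ := principalCurvatures_eq (by omega) φ_adm.1 hφG hG hxc hc1 hG'
  have hW : 0 < lapseSq c (G' c) :=
    lapseSq_pos φ_adm.1 hφG (p := x.chart) (by rwa [ofChart_chart]) (hG c hc1) hc1
  set w := √(lapseSq c (G' c)) with hw
  have hw0 : 0 < w := Real.sqrt_pos.2 hW
  have hw2 : w ^ 2 = 1 - p ^ 2 := by
    rw [hw, Real.sq_sqrt hW.le, lapseSq, hq, hcs]; field_simp; ring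
  set A := (1 + c * G' c) / w with hA
  set B := A + (c ^ 2 - 1) * (((p' - p * c / s) / s ^ 2 + c * G' c ^ 3) / w ^ 3) with hB
  have hBp : B = 1 / w + p' / w ^ 3 := by
    rw [hB, hA, hq, hcs]
    field_simp
    rw [hw2]
    ring
  have hcast : ((n - 1 : ℕ) : ℝ) = (n : ℝ) - 1 := by rw [Nat.cast_sub (by omega), Nat.cast_one]
  have hn' : (2 : ℝ) ≤ n := by exact_mod_cast hn
  set E := Real.exp (-φ x) with hE
  have hE0 : 0 < E := Real.exp_pos _
  have hH1 : meanCurvature 1 φ x = E * (((n : ℝ) - 1) * A + B) := by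
    rw [meanCurvature, hκ, esymm_one_cons_replicate, hcast]; ring
  have hH2 : meanCurvature 2 φ x =
      E ^ 2 * (((n : ℝ) - 1) / 2) * (((n : ℝ) - 2) * A ^ 2 + 2 * A * B) := by
    rw [meanCurvature, hκ, esymm_two_cons_replicate, hcast]; ring
  have h1 := φ_adm.2 x 1 (by simp)
  have h2 := φ_adm.2 x 2 (by simp)
  have hA0 : 0 < A := by
    refine pos_of_sigma_pos (m := (n : ℝ) - 2) (B := B) (by linarith) ?_ ?_
    · rw [hH1] at h1
      have := (mul_pos_iff_of_pos_left hE0).1 h1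
      linarith
    · rw [hH2] at h2
      have hn1 : (0 : ℝ) < (n - 1) / 2 := by linarith
      exact (mul_pos_iff_of_pos_left (by positivity)).1 h2
  refine ⟨w, A, B, hw0, hw2, hA0, ?_, hBp, ?_⟩
  · rw [hA, hq]; field_simp
  · have hch : ((n.choose 2 : ℕ) : ℝ) = n * ((n : ℝ) - 1) / 2 := Nat.cast_choose_two ℝ n
    have hexp : Real.exp (φ x) * E = 1 := by rw [hE, ← Real.exp_add, add_neg_cancel, Real.exp_zero]
    have hsq : H ^ 2 = Real.exp (φ x) ^ 2 * (meanCurvature 2 φ x / (n.choose 2 : ℝ)) := by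
      rw [← heq, F, mul_pow, Nat.cast_ofNat, ← Real.sqrt_eq_rpow, Real.sq_sqrt]
      positivity
    have hn0 : (n : ℝ) ≠ 0 := by positivity
    have hn1 : (n : ℝ) - 1 ≠ 0 := by linarith
    rw [hsq, hH2, hch]
    have : Real.exp (φ x) ^ 2 * E ^ 2 = 1 := by rw [← mul_pow, hexp, one_pow]
    generalize ((n : ℝ) - 2) * A ^ 2 + 2 * A * B = K
    trans Real.exp (φ x) ^ 2 * E ^ 2 * K
    · rw [this, one_mul]
    · rw [sub_add_cancel]; field_simp

theorem mainTheorem8 (n : ℕ) (hn : 2 ≤ n) (α : ℝ≥0) (hα₀ : 0 < α) (hα₁ : α < 1)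
    (h : ℝ → ℝ) (h_pos : ∀ r, 0 ≤ r → 0 < h r) (h_reg : HolderClassOn 2 α h (Ici 0))
    (h_const : ∃ ε : ℝ, 0 < ε ∧ ∀ r ∈ Ico 0 ε, h r = h 0)
    (o : Hyperboloid n) (φ₀ : ℝ) (φ : Hyperboloid n → ℝ)
    (φ_reg : RadialGraph.IsHolderClass 4 α φ)
    (φ_adm : RadialGraph.IsAdmissible 2 φ)
    (φ_eq : ∀ x : Hyperboloid n, RadialGraph.F 2 φ x = h (Hyperboloid.hdist o x))
    (φ_o : φ o = φ₀)
    (f : ℝ → ℝ) (φ_radial : ∀ x : Hyperboloid n, φ x = f (Hyperboloid.hdist o x)) :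
    ((∀ r, 0 ≤ r → h r ≤ 1) →
      AntitoneOn f (Ici 0) ∧ (φ₀ = 0 → ∀ x, φ x ≤ 0)) ∧
    ((∀ r, 0 ≤ r → 1 ≤ h r) →
      MonotoneOn f (Ici 0) ∧ (φ₀ = 0 → ∀ x, 0 ≤ φ x)) := by
  obtain ⟨γ, hγ, hγ_smooth⟩ := exists_geodesic (by omega) o
  have hdist_γ : ∀ r, hdist o (γ r) = |r| := by
    intro r
    rw [hdist, hγ, neg_neg, ← Real.cosh_abs, Real.arcosh_cosh (abs_nonneg r)]
  set g : ℝ → ℝ := fun r => φ (γ r) with hg_def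
  have hgf : ∀ r, g r = f |r| := fun r => by rw [hg_def, ← hdist_γ]; exact φ_radial _
  have hg : ContDiff ℝ 2 g := by
    have h1 : ContDiff ℝ 2 fun p => φ (ofChart p) :=
      (contDiffOn_univ.1 φ_reg.1).of_le (by norm_num)
    simpa only [Function.comp_def, ofChart_chart] using h1.comp hγ_smooth
  have hφg : ∀ x, φ x = g (hdist o x) := fun x => by
    rw [hgf, abs_of_nonneg (hdist_nonneg o x), φ_radial]
  have hfg : EqOn g f (Ici 0) := fun r hr => by rw [hgf, abs_of_nonneg hr]
  have hd1 : Differentiable ℝ g := hg.differentiable (by norm_num)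
  have hd2 : ∀ t, HasDerivAt (deriv g) (deriv (deriv g) t) t := fun t =>
    (((contDiff_succ_iff_deriv (n := 1)).1 hg).2.2.differentiable (by norm_num) t).hasDerivAt
  -- `g` is even, so its derivative vanishes at the centre.
  have hg0 : deriv g 0 = 0 := by
    have heven : (fun r => g (-r)) = g := by funext r; rw [hgf, hgf, abs_neg]
    have h1 := deriv_comp_neg g 0
    rw [heven, neg_zero] at h1
    linarith
  have hode : ∀ r : ℝ, 0 < r → _ := fun r hr =>
    radial_equation hn φ_adm hg hφg hr (hγ r) ((φ_eq (γ r)).trans (by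
      rw [hdist_γ, abs_of_pos hr] : _ = h r))
  have hm : (0 : ℝ) ≤ (n : ℝ) - 2 := by
    have : (2 : ℝ) ≤ n := by exact_mod_cast hn
    linarith
  have hcoth : ∀ r : ℝ, 0 < r → 1 < Real.cosh r / Real.sinh r := fun r hr => by
    rw [lt_div_iff₀ (Real.sinh_pos_iff.2 hr), one_mul]; exact Real.sinh_lt_cosh r
  have hf0 : f 0 = φ₀ := by rw [← φ_o, φ_radial, hdist_self]
  refine ⟨fun hle => ?_, fun hge => ?_⟩
  · have hnonpos : ∀ r, 0 ≤ r → deriv g r ≤ 0 := fun r hr =>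
      nonpos_of_deriv_neg_of_pos hd2 hg0 (fun r hr hp => by
        obtain ⟨w, A, B, hw, hw2, -, hA, hB, heq⟩ := hode r hr
        exact deriv_neg_of_curvature_le hm (hcoth r hr) hw hw2 hA hB heq
          (pow_le_one₀ (h_pos r hr.le).le (hle r hr.le)) hp) hr
    have hanti : AntitoneOn f (Ici 0) := AntitoneOn.congr
      (antitoneOn_of_deriv_nonpos (convex_Ici 0) hd1.continuous.continuousOn hd1.differentiableOn
        fun r hr => hnonpos r (interior_subset hr)) hfg
    refine ⟨hanti, fun h0 x => ?_⟩
    rw [φ_radial, ← h0, ← hf0]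
    exact hanti self_mem_Ici (hdist_nonneg o x) (hdist_nonneg o x)
  · have hnonneg : ∀ r, 0 ≤ r → 0 ≤ deriv g r := fun r hr => by
      have := nonpos_of_deriv_neg_of_pos (fun t => (hd2 t).fun_neg) (by rw [hg0, neg_zero])
        (fun r hr hp => by
          obtain ⟨w, A, B, hw, hw2, hA0, hA, hB, heq⟩ := hode r hr
          exact neg_neg_of_pos (deriv_pos_of_le_curvature hm (hcoth r hr) hw hw2 hA hB heq
            (one_le_pow₀ (hge r hr.le)) hA0 (neg_pos.1 hp))) hr
      linarith
    have hmono : MonotoneOn f (Ici 0) := MonotoneOn.congr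
      (monotoneOn_of_deriv_nonneg (convex_Ici 0) hd1.continuous.continuousOn hd1.differentiableOn
        fun r hr => hnonneg r (interior_subset hr)) hfg
    refine ⟨hmono, fun h0 x => ?_⟩
    rw [φ_radial, ← h0, ← hf0]
    exact hmono self_mem_Ici (hdist_nonneg o x) (hdist_nonneg o x)

end
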